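/- Let $\gamma,U_1,\delta,U_2,X$ be real random variables on a probability space, let $Y_1=\gamma Y_2+U_1$ and $Y_2=\delta X+U_2$, and let $X$ be independent of $\theta=(\gamma,U_1,\delta,U_2)$. One observes $Z=(Y_1,Y_2,X)$. Let $\eta_0$ be the law of $\theta$. The reduced form is $Y=\alpha_0+\alpha_1X$ with $Y=(Y_1,Y_2)$, $\alpha_0=(\pi_0,U_2)$, $\alpha_1=(\pi_1,\delta)$, $\pi_0=\gamma U_2+U_1$, $\pi_1=\gamma\delta$. Suppose that $\alpha=(\alpha_0,\alpha_1)$ has a bounded Lebesgue density and bounded support; that $X$ has a bounded Lebesgue density; that $N\subseteq\mathbb{R}^4$ is an open set on which the density of $\alpha$ is positive almost everywhere; and that for almost every value $x$ of $X$ the vector $\alpha_0+\alpha_1x$ has a continuous density $\eta_{0,x}$ on $\mathbb{R}^2$ with $\inf_{\alpha\in N}\eta_{0,x}(\alpha_0+\alpha_1x)\ge 1/l(x)$, where $l>0$ is measurable and $\mathbb{E}[l(X)^2]<\infty$. Let $H$ be a class of probability distributions on $\mathbb{R}^4$ (possible laws of $\theta$) with $\eta_0\in H$, and let $\phi(\eta)=\mathbb{E}_\eta[r(\theta)]$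 be a moment. A submodel with score $b\in L_2(\eta_0)$ is a path $\eta_t\in H$, $0\le t<\varepsilon$, starting at $\eta_0$, with $\int[(d\eta_t^{1/2}-d\eta_0^{1/2})/t-\tfrac12 b\,d\eta_0^{1/2}]^2\to0$ as $t\downarrow0$, along which $\mathbb{E}_{\eta_t}[r^2]$ stays bounded for small $t>0$ (automatic for bounded $r$). The tangent space $T(\eta_0)$ is the linear span of the scores. Assume that the heterogeneity is nonparametric: $T(\eta_0)$ is dense in the subspace of mean zero functions of $L_2(\eta_0)$. An influence function of $\phi$ is a mean zero $\chi\in L_2(\eta_0)$ with $(\phi(\eta_t)-\phi(\eta_0))/t\to\mathbb{E}_{\eta_0}[\chi b]$ as $t\downarrow0$ for every submodel, and the efficiency bound of $\phi$ is $$\sup_{b\in T(\eta_0)}\frac{\left(\mathbb{E}_{\eta_0}[\chi b]\right)^2}{\mathbb{E}\left[\mathbb{E}[b(\theta)\mid Z]^2\right]}\in[0,\infty]\qquad(c/0=\infty\text{ for }c>0,\ 0/0=0).$$ The parameter $\phi(\eta_0)$ is regularly identified if it is identified within $H$ from the law of $Z$ (the law of $X$ being known), $\phi$ has an influence function, and the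 efficiency bound is finite. (a) If $(p_0,u_2,0,d_0)\in N$ for some $p_0,u_2,d_0$, or $(p_0,u_2,p_1,0)\in N$ for some $p_0,u_2,p_1$ (coordinates $(\pi_0,U_2,\pi_1,\delta)$), then the proportion of positive marginal effects $\mathbb{E}_{\eta_0}[1(\gamma>0)]$ is not regularly identified: it has an influence function, and its efficiency bound is infinite. (b) If $(p_0,u_2,p_1,0)\in N$ for some $p_0,u_2,p_1$ and $\mathbb{E}[\gamma^2]<\infty$, then the average marginal effect $\mathbb{E}_{\eta_0}[\gamma]$ is not regularly identified: it has an influence function, and its efficiency bound is infinite. -/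

import Mathlib

open MeasureTheory ProbabilityTheory Filter Topology
open scoped ENNReal NNReal

namespace TriangularRC

noncomputable section

/-- Values `(γ, U₁, δ, U₂)` of the random coefficients of the triangular model. -/
abbrev Coef : Type := ℝ × ℝ × ℝ × ℝ

/-- Values `((π₀, U₂), (π₁, δ)) = (α₀, α₁)` of the reduced form coefficients. -/
abbrev RCoef : Type := (ℝ × ℝ) × (ℝ × ℝ)

/-- Reduced form coefficients: `π₀ = γ U₂ + U₁` and `π₁ = γ δ`. -/
def reducedForm (θ : Coef) : RCoef :=
  ((θ.1 * θ.2.2.2 + θ.2.1, θ.2.2.2), (θ.1 * θ.2.2.1, θ.2.2.1))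

/-- The observation `(Y₁, Y₂, X)` generated by coefficients `(γ, U₁, δ, U₂)` and instrument `x`. -/
def observation (w : Coef × ℝ) : ℝ × ℝ × ℝ :=
  (w.1.1 * (w.1.2.2.1 * w.2 + w.1.2.2.2) + w.1.2.1, w.1.2.2.1 * w.2 + w.1.2.2.2, w.2)

/-- The law of the data when the coefficients have law `η` and are independent of the instrument,
which has law `ν`. -/
def observedLaw (η : Measure Coef) (ν : Measure ℝ) : Measure (ℝ × ℝ × ℝ) :=
  (η.prod ν).map observation

/-- The triangular random coefficient model, with an instrument independent of all the random
coefficients. -/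
structure IsTriangularModel {Ω : Type*} [MeasurableSpace Ω] (P : Measure Ω)
    (γ U₁ δ U₂ X Y₁ Y₂ : Ω → ℝ) : Prop where
  measurable_γ : Measurable γ
  measurable_U₁ : Measurable U₁
  measurable_δ : Measurable δ
  measurable_U₂ : Measurable U₂
  measurable_X : Measurable X
  outcome : ∀ ω, Y₁ ω = γ ω * Y₂ ω + U₁ ω
  firstStage : ∀ ω, Y₂ ω = δ ω * X ω + U₂ ω
  exogenous : IndepFun (fun ω => ((γ ω, U₁ ω, δ ω, U₂ ω) : Coef)) X P

/-- A measure that is absolutely continuous with a bounded Lebesgue density. -/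
def HasBoundedDensity {E : Type*} [MeasureSpace E] (μ : Measure E) : Prop :=
  ∃ (f : E → ℝ≥0∞) (C : ℝ≥0), Measurable f ∧ (∀ x, f x ≤ C) ∧ μ = volume.withDensity f

/-- The conditions on the reduced form `Y = α₀ + α₁ X`, where `η` is the law of `(α₀, α₁)`, `ν` is
the law of `X`, and `N` is an open set of values of `(α₀, α₁)`. -/
structure ReducedFormCondition (η : Measure RCoef) (ν : Measure ℝ) (N : Set RCoef) : Prop where
  isOpen : IsOpen N
  /-- `N` lies in the support of `α`: the Lebesgue density of `η` is positive a.e. on `N`. -/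
  positive : volume.restrict N ≪ η
  boundedDensity : HasBoundedDensity η
  boundedSupport : ∃ S : Set RCoef, Bornology.IsBounded S ∧ η Sᶜ = 0
  /-- The density `h x` of `α₀ + α₁ x` is continuous, and it is at least `1 / l x` at the points
  `α₀ + α₁ x` with `α ∈ N`, where `E[l(X)²] < ∞`. -/
  outcomeDensity : ∃ (h : ℝ → ℝ × ℝ → ℝ) (l : ℝ → ℝ),
    Measurable l ∧ (∀ x, 0 < l x) ∧ Integrable (fun x => l x ^ 2) ν ∧
    ∀ᵐ x ∂ν, Continuous (h x) ∧ (∀ y, 0 ≤ h x y) ∧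
      η.map (fun a => a.1 + x • a.2) = volume.withDensity (fun y => ENNReal.ofReal (h x y)) ∧
      ∀ a ∈ N, 1 / l x ≤ h x (a.1 + x • a.2)
  instrumentDensity : HasBoundedDensity ν

section Efficiency

variable {E : Type*} [MeasurableSpace E]

/-- Mean square differentiability at `t = 0`, from the right, of the path `t ↦ η t` with score `b`:
`∫ [(dη_t^{1/2} - dη₀^{1/2}) / t - (1/2) b dη₀^{1/2}]² → 0`, the densities being taken with respect
to `η_t + η₀`. -/
def HasScore (η₀ : Measure E) (η : ℝ → Measure E) (b : Lp ℝ 2 η₀) : Prop :=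
  Tendsto (fun t : ℝ => ∫⁻ a, ENNReal.ofReal
      (((√((η t).rnDeriv (η t + η₀) a).toReal - √(η₀.rnDeriv (η t + η₀) a).toReal) / t
        - 1 / 2 * b a * √(η₀.rnDeriv (η t + η₀) a).toReal) ^ 2) ∂(η t + η₀))
    (𝓝[>] 0) (𝓝 0)

/-- `η` is a parametric submodel of the class `H` through `η₀`, with score `b`, for the study of the
moment `E_η[r]`: the second moment of `r` stays bounded along it (no restriction if `r` is
bounded). -/
structure IsSubmodel (H : Set (Measure E)) (r : E → ℝ) (η₀ : Measure E) (η : ℝ → Measure E)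
    (b : Lp ℝ 2 η₀) : Prop where
  start : η 0 = η₀
  mem : ∃ ε > 0, ∀ t ∈ Set.Ico (0 : ℝ) ε, η t ∈ H
  score : HasScore η₀ η b
  moment : ∃ C : ℝ≥0, ∀ᶠ t in 𝓝[>] (0 : ℝ), ∫⁻ a, ENNReal.ofReal (r a ^ 2) ∂(η t) ≤ C

/-- The tangent space: the linear span of the scores of the submodels. -/
def tangentSpace (H : Set (Measure E)) (r : E → ℝ) (η₀ : Measure E) : Submodule ℝ (Lp ℝ 2 η₀) :=
  Submodule.span ℝ {b | ∃ η : ℝ → Measure E, IsSubmodel H r η₀ η b}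

/-- Unobserved heterogeneity is nonparametric: the tangent space is dense in the mean zero
functions of `L₂(η₀)`. -/
def IsNonparametric (H : Set (Measure E)) (r : E → ℝ) (η₀ : Measure E) : Prop :=
  ∀ b : Lp ℝ 2 η₀, ∫ a, b a ∂η₀ = 0 → b ∈ closure (tangentSpace H r η₀ : Set (Lp ℝ 2 η₀))

/-- `χ` is an influence function (gradient) at `η₀` of the functional `η ↦ E_η[r]`. -/
def IsInfluenceFunction (H : Set (Measure E)) (r : E → ℝ) (η₀ : Measure E)
    (χ : Lp ℝ 2 η₀) : Prop :=
  ∫ a, χ a ∂η₀ = 0 ∧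
  ∀ (η : ℝ → Measure E) (b : Lp ℝ 2 η₀), IsSubmodel H r η₀ η b →
    Tendsto (fun t : ℝ => (∫ a, r a ∂(η t) - ∫ a, r a ∂η₀) / t) (𝓝[>] 0) (𝓝 (∫ a, χ a * b a ∂η₀))

variable {Ω : Type*} [MeasurableSpace Ω] {F : Type*} [MeasurableSpace F]

/-- The score operator `b ↦ E[b(θ) | Z]`, giving the scores of the model for the observed data. -/
def scoreOperator (P : Measure Ω) (θ : Ω → E) (Z : Ω → F) (b : Lp ℝ 2 (P.map θ)) : Ω → ℝ :=
  P[fun ω => b (θ ω) | MeasurableSpace.comap Z inferInstance]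

/-- The efficiency bound of the functional `η ↦ E_η[r]` with influence function `χ`: the supremum
over tangents `b` of the squared derivative `E[χ b]²` over the Fisher information
`E[E[b(θ) | Z]²]` (with `c / 0 = ∞` for `c > 0` and `0 / 0 = 0`). -/
def efficiencyBound (P : Measure Ω) (θ : Ω → E) (Z : Ω → F) (H : Set (Measure E)) (r : E → ℝ)
    (χ : Lp ℝ 2 (P.map θ)) : ℝ≥0∞ :=
  ⨆ b ∈ tangentSpace H r (P.map θ),
    ENNReal.ofReal ((∫ a, χ a * b a ∂(P.map θ)) ^ 2) / eLpNorm (scoreOperator P θ Z b) 2 P ^ 2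

/-- The functional `η ↦ E_η[r]` is differentiable with an infinite efficiency bound. -/
def HasInfiniteEfficiencyBound (P : Measure Ω) (θ : Ω → E) (Z : Ω → F) (H : Set (Measure E))
    (r : E → ℝ) : Prop :=
  ∃ χ, IsInfluenceFunction H r (P.map θ) χ ∧ efficiencyBound P θ Z H r χ = ⊤

end Efficiency

/-- `E_η[r]` is identified at `η₀` within the class `H`, the law `ν` of the instrument being
known. -/
def IsIdentified (H : Set (Measure Coef)) (r : Coef → ℝ) (η₀ : Measure Coef)
    (ν : Measure ℝ) : Prop :=
  ∀ η ∈ H, Integrable r η → observedLaw η ν = observedLaw η₀ ν → ∫ a, r a ∂η = ∫ a, r a ∂η₀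

/-- Regular identification: identification with a finite efficiency bound. -/
def IsRegularlyIdentified {Ω : Type*} [MeasurableSpace Ω] (P : Measure Ω)
    (θ : Ω → Coef) (X : Ω → ℝ) (Z : Ω → ℝ × ℝ × ℝ) (H : Set (Measure Coef))
    (r : Coef → ℝ) : Prop :=
  IsIdentified H r (P.map θ) (P.map X) ∧
  ∃ χ, IsInfluenceFunction H r (P.map θ) χ ∧ efficiencyBound P θ Z H r χ < ⊤

/-- The moment function of the average marginal effect `E[γ]`. -/
def ame (θ : Coef) : ℝ := θ.1

/-- The moment function of the proportion of positive marginal effects `P(γ > 0)`. -/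
def ppame (θ : Coef) : ℝ := Set.indicator {θ : Coef | 0 < θ.1} (fun _ => (1 : ℝ)) θ

end

end TriangularRC

namespace TriangularRC

/-! Suppose the bound is finite. Then the inner product of the centred moment with a tangent `b` is
controlled by the norm of `E[b(θ) | Z]`, and, the tangent space being dense, this extends to all
mean zero `b`. Hahn–Banach and Riesz put the influence function in the range of the adjoint of the
score operator: `r(θ) - E[r] = E[g(Z) | θ]` with `g(Z)` square integrable. By independence the right
side is `∫ G (α₀ + x α₁, x) dν(x)`, where `ν` is the law of `X`.

Both moments depend on the slopes alone, through `γ = π₁ / δ`. Averaging over a ball of intercepts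
therefore leaves the left side unchanged, while on the right the substitution `y = α₀ + x α₁` leaves
the slopes only in the indicator of a moving ball. The lower bound `1 / l` on the outcome density
dominates the integrand, with integral at most `E[l(X) |g(Z)|] < ∞`. So the average is continuous at
the given slopes, and `r` has an essential limit there (`exists_tendsto_nhds_inf_ae`). But `1(π₁ / δ
> 0)` has none where `π₁ δ = 0`, and `π₁ / δ` none where `δ = 0`.

The influence function exists because moments bounded in mean square are differentiable along scored
paths (`tendsto_of_hasScore`). -/

/-! ### Differentiability of moments along paths with a score. -/

theorem sq_integral_mul_le {E : Type*} [MeasurableSpace E] {m : Measure E} {f g : E → ℝ}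
    (hf : MemLp f 2 m) (hg : MemLp g 2 m) :
    (∫ a, f a * g a ∂m) ^ 2 ≤ (∫ a, f a ^ 2 ∂m) * ∫ a, g a ^ 2 ∂m := by
  have key := real_inner_mul_inner_self_le (hf.toLp f) (hg.toLp g)
  simp only [L2.inner_def] at key
  have e : ∀ {u v : E → ℝ} (hu : MemLp u 2 m) (hv : MemLp v 2 m),
      ∫ a, inner ℝ (hu.toLp u a) (hv.toLp v a) ∂m = ∫ a, u a * v a ∂m := by
    intro u v hu hv
    refine integral_congr_ae ?_
    filter_upwards [hu.coeFn_toLp, hv.coeFn_toLp] with a h1 h2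
    rw [h1, h2]
    simp [mul_comm]
  rw [e, e, e] at key
  simpa only [pow_two] using key

/-- The difference quotient of a moment along a path, in terms of the square roots `s` and `s₀` of
the densities and of the remainder in the mean square expansion of `s`. -/
theorem abs_sub_le_of_root_density {E : Type*} [MeasurableSpace E] {m : Measure E}
    {s s₀ r b : E → ℝ} (hs : MemLp s 2 m) (hs₀ : MemLp s₀ 2 m)
    (hr : Measurable r)
    (hrs : MemLp (fun a => r a * s a) 2 m) (hrs₀ : MemLp (fun a => r a * s₀ a) 2 m)
    (hb : MemLp (fun a => b a * s₀ a) 2 m)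
    {t : ℝ} (ht : 0 < t) {K : ℝ} (hK : 0 ≤ K) {M : ℝ}
    (hM : ∫ a, (r a * s a) ^ 2 ∂m ≤ M) (hM₀ : ∫ a, (r a * s₀ a) ^ 2 ∂m ≤ M) :
    let e := ∫ a, ((s a - s₀ a) / t - 1 / 2 * b a * s₀ a) ^ 2 ∂m
    let B := ∫ a, (b a * s₀ a) ^ 2 ∂m
    let B' := ∫ a, ({a | K < |r a|}.indicator b a * s₀ a) ^ 2 ∂m
    |((∫ a, r a * s a ^ 2 ∂m) - ∫ a, r a * s₀ a ^ 2 ∂m) / t - ∫ a, r a * b a * s₀ a ^ 2 ∂m| ≤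
      √(e * (4 * M)) + (√(K ^ 2 * B * (t ^ 2 * (2 * e + B))) + √(B' * (4 * M))) := by
  intro e B B'
  set A : Set E := {a | K < |r a|} with hA
  have hAm : MeasurableSet A := measurableSet_lt measurable_const hr.abs
  set Δ : E → ℝ := fun a => (s a - s₀ a) / t - 1 / 2 * b a * s₀ a with hΔ
  have hΔ2 : MemLp Δ 2 m := by
    have := ((hs.sub hs₀).const_mul t⁻¹).sub (hb.const_mul (1 / 2))
    refine this.congr_norm this.1 ?_ |>.ae_eq ?_
    · exact ae_of_all _ fun _ => rfl
    · refine ae_of_all _ fun a => ?_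
      simp only [hΔ, Pi.sub_apply]
      ring
  have hsum : MemLp (fun a => r a * s a + r a * s₀ a) 2 m := hrs.add hrs₀
  have hdif : MemLp (fun a => r a * s a - r a * s₀ a) 2 m := hrs.sub hrs₀
  have hd : MemLp (fun a => s a - s₀ a) 2 m := hs.sub hs₀
  have hbA : MemLp (fun a => A.indicator b a * s₀ a) 2 m := by
    refine (hb.indicator hAm).ae_eq (ae_of_all _ fun a => ?_)
    by_cases h : a ∈ A <;> simp [h]
  have hrb : MemLp (fun a => Aᶜ.indicator r a * (b a * s₀ a)) 2 m := by
    refine MemLp.of_le_mul (c := K) hb ((hr.indicator hAm.compl).aestronglyMeasurable.mul hb.1)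
      (ae_of_all _ fun a => ?_)
    rw [norm_mul]
    refine mul_le_mul_of_nonneg_right ?_ (norm_nonneg _)
    by_cases h : a ∈ A
    · simpa [h] using hK
    · have hc : a ∈ Aᶜ := h
      rw [Set.indicator_of_mem hc]
      simpa [hA] using h
  have i1 := (hrs.integrable_mul hs)
  have i2 := (hrs₀.integrable_mul hs₀)
  have i3 := (hrs₀.integrable_mul hb)
  have j1 : Integrable (fun a => Δ a * (r a * s a + r a * s₀ a)) m := hΔ2.integrable_mul hsum
  have j2 : Integrable (fun a => Aᶜ.indicator r a * (b a * s₀ a) * (s a - s₀ a)) m :=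
    hrb.integrable_mul hd
  have j3 : Integrable (fun a => A.indicator b a * s₀ a * (r a * s a - r a * s₀ a)) m :=
    hbA.integrable_mul hdif
  -- Factor `s² - s₀² = (s - s₀)(s + s₀)` and insert `(s - s₀) / t = Δ + b s₀ / 2`. The leftover `r
  -- b s₀ (s - s₀) / 2` is cut at `|r| = K`: below the cut `r` is bounded and `s - s₀` is small,
  -- above it the tail of `b` is small.
  have split : ((∫ a, r a * s a ^ 2 ∂m) - ∫ a, r a * s₀ a ^ 2 ∂m) / t
        - ∫ a, r a * b a * s₀ a ^ 2 ∂m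
      = (∫ a, Δ a * (r a * s a + r a * s₀ a) ∂m) +
        (1 / 2 * (∫ a, Aᶜ.indicator r a * (b a * s₀ a) * (s a - s₀ a) ∂m) +
         1 / 2 * ∫ a, A.indicator b a * s₀ a * (r a * s a - r a * s₀ a) ∂m) := by
    have h1 : Integrable (fun a => r a * s a ^ 2) m := i1.congr (ae_of_all _ fun a => by
      simp only [Pi.mul_apply]; ring)
    have h2 : Integrable (fun a => r a * s₀ a ^ 2) m := i2.congr (ae_of_all _ fun a => by
      simp only [Pi.mul_apply]; ring)
    have h3 : Integrable (fun a => r a * b a * s₀ a ^ 2) m := i3.congr (ae_of_all _ fun a => by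
      simp only [Pi.mul_apply]; ring)
    have h12 : Integrable (fun a => (r a * s a ^ 2 - r a * s₀ a ^ 2) / t) m :=
      (h1.sub h2).div_const _
    have j23 : Integrable (fun a => 1 / 2 * (Aᶜ.indicator r a * (b a * s₀ a) * (s a - s₀ a)) +
        1 / 2 * (A.indicator b a * s₀ a * (r a * s a - r a * s₀ a))) m :=
      (j2.const_mul _).add (j3.const_mul _)
    rw [← integral_sub h1 h2, ← integral_div, ← integral_sub h12 h3,
      ← integral_const_mul, ← integral_const_mul,
      ← integral_add (j2.const_mul _) (j3.const_mul _),
      ← integral_add j1 j23]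
    refine integral_congr_ae (ae_of_all _ fun a => ?_)
    by_cases h : a ∈ A
    · simp only [hΔ, h, Set.indicator_of_mem, Set.mem_compl_iff, not_true_eq_false,
        not_false_eq_true, Set.indicator_of_notMem]
      field_simp
      ring
    · simp only [hΔ, h, Set.indicator_of_mem, Set.mem_compl_iff,
        not_false_eq_true, Set.indicator_of_notMem]
      field_simp
      ring
  have sqint : ∀ {f : E → ℝ}, MemLp f 2 m → Integrable (fun a => f a ^ 2) m :=
    fun h => h.integrable_sq
  have par : ∀ {f g u : E → ℝ}, MemLp f 2 m → MemLp g 2 m →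
      (∀ a, u a ^ 2 ≤ 2 * f a ^ 2 + 2 * g a ^ 2) →
      ∫ a, u a ^ 2 ∂m ≤ 2 * (∫ a, f a ^ 2 ∂m) + 2 * ∫ a, g a ^ 2 ∂m := by
    intro f g u hf hg hu
    rw [← integral_const_mul, ← integral_const_mul,
      ← integral_add ((sqint hf).const_mul _) ((sqint hg).const_mul _)]
    exact integral_mono_of_nonneg (ae_of_all _ fun a => sq_nonneg _)
      (((sqint hf).const_mul _).add ((sqint hg).const_mul _)) (ae_of_all _ hu)
  have e0 : 0 ≤ e := integral_nonneg fun _ => sq_nonneg _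
  have B0 : 0 ≤ B := integral_nonneg fun _ => sq_nonneg _
  have B'0 : 0 ≤ B' := integral_nonneg fun _ => sq_nonneg _
  have q1 : ∫ a, (r a * s a + r a * s₀ a) ^ 2 ∂m ≤ 4 * M := by
    have := par (u := fun a => r a * s a + r a * s₀ a) hrs hrs₀ fun a => by
      nlinarith [sq_nonneg (r a * s a - r a * s₀ a)]
    linarith
  have q2 : ∫ a, (r a * s a - r a * s₀ a) ^ 2 ∂m ≤ 4 * M := by
    have := par (u := fun a => r a * s a - r a * s₀ a) hrs hrs₀ fun a => by
      nlinarith [sq_nonneg (r a * s a + r a * s₀ a)]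
    linarith
  have q3 : ∫ a, (s a - s₀ a) ^ 2 ∂m ≤ t ^ 2 * (2 * e + B) := by
    have := par (u := fun a => t⁻¹ * (s a - s₀ a)) hΔ2 (hb.const_mul (1 / 2)) fun a => by
      simp only [hΔ]
      rw [div_eq_inv_mul]
      nlinarith [sq_nonneg (t⁻¹ * (s a - s₀ a) - b a * s₀ a)]
    simp only [mul_pow] at this
    rw [integral_const_mul, integral_const_mul] at this
    have hBe : ∫ a, b a ^ 2 * s₀ a ^ 2 ∂m = B := by simp only [B, mul_pow]
    rw [hBe] at this
    have h2 : (t⁻¹) ^ 2 * ∫ a, (s a - s₀ a) ^ 2 ∂m ≤ 2 * e + B := by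
      change _ ≤ 2 * e + _ at this
      linarith
    calc ∫ a, (s a - s₀ a) ^ 2 ∂m = t ^ 2 * ((t⁻¹) ^ 2 * ∫ a, (s a - s₀ a) ^ 2 ∂m) := by
          field_simp
      _ ≤ _ := mul_le_mul_of_nonneg_left h2 (sq_nonneg t)
  have q4 : ∫ a, (Aᶜ.indicator r a * (b a * s₀ a)) ^ 2 ∂m ≤ K ^ 2 * B := by
    rw [← integral_const_mul]
    refine integral_mono (sqint hrb) ((sqint hb).const_mul _) fun a => ?_
    simp only
    rw [mul_pow]
    refine mul_le_mul_of_nonneg_right ?_ (sq_nonneg _)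
    by_cases h : a ∈ A
    · simpa [h] using sq_nonneg K
    · simp only [hA, Set.mem_ofPred_eq, not_lt] at h
      have hc : a ∈ Aᶜ := by simpa [hA] using h
      rw [Set.indicator_of_mem hc]
      exact sq_le_sq' (by linarith [neg_abs_le (r a)]) (by linarith [le_abs_self (r a)])
  have b1 : |∫ a, Δ a * (r a * s a + r a * s₀ a) ∂m| ≤ √(e * (4 * M)) :=
    Real.abs_le_sqrt ((sq_integral_mul_le hΔ2 hsum).trans (mul_le_mul_of_nonneg_left q1 e0))
  have b2 : |∫ a, Aᶜ.indicator r a * (b a * s₀ a) * (s a - s₀ a) ∂m| ≤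
      √(K ^ 2 * B * (t ^ 2 * (2 * e + B))) :=
    Real.abs_le_sqrt ((sq_integral_mul_le hrb hd).trans
      (mul_le_mul q4 q3 (integral_nonneg fun _ => sq_nonneg _) (by positivity)))
  have b3 : |∫ a, A.indicator b a * s₀ a * (r a * s a - r a * s₀ a) ∂m| ≤ √(B' * (4 * M)) :=
    Real.abs_le_sqrt ((sq_integral_mul_le hbA hdif).trans (mul_le_mul_of_nonneg_left q2 B'0))
  rw [split]
  refine (abs_add_le _ _).trans (add_le_add b1 ((abs_add_le _ _).trans (add_le_add ?_ ?_)))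
  · rw [abs_mul, abs_of_nonneg (by norm_num : (0 : ℝ) ≤ 1 / 2)]
    linarith [abs_nonneg (∫ a, Aᶜ.indicator r a * (b a * s₀ a) * (s a - s₀ a) ∂m)]
  · rw [abs_mul, abs_of_nonneg (by norm_num : (0 : ℝ) ≤ 1 / 2)]
    linarith [abs_nonneg (∫ a, A.indicator b a * s₀ a * (r a * s a - r a * s₀ a) ∂m)]

/-- Moments that are bounded in mean square along a path with a score are differentiable along
it. -/
theorem tendsto_of_hasScore {E : Type*} [MeasurableSpace E] {η₀ : Measure E}
    [IsProbabilityMeasure η₀] {η : ℝ → Measure E}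
    (hη : ∀ᶠ t in 𝓝[>] (0 : ℝ), IsProbabilityMeasure (η t)) {b : Lp ℝ 2 η₀}
    (hb : HasScore η₀ η b) {r : E → ℝ} (hr : Measurable r)
    (hr0 : Integrable (fun a => r a ^ 2) η₀) {C : ℝ≥0}
    (hC : ∀ᶠ t in 𝓝[>] (0 : ℝ), ∫⁻ a, ENNReal.ofReal (r a ^ 2) ∂(η t) ≤ C) :
    Tendsto (fun t : ℝ => (∫ a, r a ∂(η t) - ∫ a, r a ∂η₀) / t) (𝓝[>] 0)
      (𝓝 (∫ a, r a * b a ∂η₀)) := by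
  set M : ℝ := max C (∫ a, r a ^ 2 ∂η₀) with hM
  set B : ℝ := ∫ a, b a ^ 2 ∂η₀ with hB
  set I : ℝ → ℝ≥0∞ := fun t => ∫⁻ a, ENNReal.ofReal
      (((√((η t).rnDeriv (η t + η₀) a).toReal - √(η₀.rnDeriv (η t + η₀) a).toReal) / t
        - 1 / 2 * b a * √(η₀.rnDeriv (η t + η₀) a).toReal) ^ 2) ∂(η t + η₀) with hI
  have hb2 : Integrable (fun a => b a ^ 2) η₀ := (Lp.memLp b).integrable_sq
  have hbm : Measurable b := (Lp.stronglyMeasurable b).measurable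
  set B' : ℕ → ℝ := fun K => ∫ a, ({a | (K : ℝ) < |r a|}.indicator b a) ^ 2 ∂η₀ with hB'
  have hB'lim : Tendsto B' atTop (𝓝 0) := by
    rw [show (0 : ℝ) = ∫ _, (0 : ℝ) ∂η₀ by simp]
    refine tendsto_integral_of_dominated_convergence (fun a => b a ^ 2) (fun K => ?_) hb2
      (fun K => ae_of_all _ fun a => ?_) (ae_of_all _ fun a => ?_)
    · exact ((hbm.indicator (measurableSet_lt measurable_const hr.abs)).pow_const
        2).aestronglyMeasurable
    · rw [Real.norm_of_nonneg (sq_nonneg _)]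
      by_cases h : a ∈ {a | (K : ℝ) < |r a|}
      · rw [Set.indicator_of_mem h]
      · rw [Set.indicator_of_notMem h]
        simpa using sq_nonneg (b a)
    · obtain ⟨n, hn⟩ := exists_nat_ge |r a|
      refine tendsto_const_nhds.congr' ?_
      filter_upwards [eventually_ge_atTop n] with K hK
      have : a ∉ {a | (K : ℝ) < |r a|} := by
        simp only [Set.mem_ofPred_eq, not_lt]
        exact hn.trans (by exact_mod_cast hK)
      rw [Set.indicator_of_notMem this]
      simp
  have bound : ∀ K : ℕ, ∀ᶠ t in 𝓝[>] (0 : ℝ),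
      |(∫ a, r a ∂(η t) - ∫ a, r a ∂η₀) / t - ∫ a, r a * b a ∂η₀| ≤
        √((I t).toReal * (4 * M)) +
          (√((K : ℝ) ^ 2 * B * (t ^ 2 * (2 * (I t).toReal + B))) + √(B' K * (4 * M))) := by
    intro K
    filter_upwards [hη, hC, self_mem_nhdsWithin] with t hp hCt ht
    set m := η t + η₀ with hm
    have ac : η t ≪ m := Measure.AbsolutelyContinuous.rfl.add_right _
    have ac₀ : η₀ ≪ m := by
      rw [hm, add_comm]
      exact Measure.AbsolutelyContinuous.rfl.add_right _
    have hsq : ∀ (μ : Measure E) (a : E),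
        √(μ.rnDeriv m a).toReal ^ 2 = (μ.rnDeriv m a).toReal :=
      fun μ a => Real.sq_sqrt ENNReal.toReal_nonneg
    have hsm : ∀ μ : Measure E, Measurable fun a => √(μ.rnDeriv m a).toReal := fun μ =>
      (μ.measurable_rnDeriv m).ennreal_toReal.sqrt
    -- The dominating measure `m` varies with `t`; this removes it, turning integrals against
    -- squared root densities into integrals against `η t` and `η₀`.
    have tr : ∀ (μ : Measure E) [IsProbabilityMeasure μ], μ ≪ m → ∀ f : E → ℝ,
        ∫ a, f a * √(μ.rnDeriv m a).toReal ^ 2 ∂m = ∫ a, f a ∂μ := by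
      intro μ _ hac f
      rw [← integral_rnDeriv_smul hac]
      refine integral_congr_ae (ae_of_all _ fun a => ?_)
      simp only [hsq, smul_eq_mul, mul_comm]
    have trL : ∀ (μ : Measure E) [IsProbabilityMeasure μ], μ ≪ m → ∀ f : E → ℝ, Measurable f →
        Integrable (fun a => f a ^ 2) μ → MemLp (fun a => f a * √(μ.rnDeriv m a).toReal) 2 m := by
      intro μ _ hac f hf hfi
      refine (memLp_two_iff_integrable_sq (hf.mul (hsm μ)).aestronglyMeasurable).2 ?_
      refine ((integrable_rnDeriv_smul_iff hac).2 hfi).congr (ae_of_all _ fun a => ?_)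
      simp only [Pi.mul_apply, mul_pow, hsq, smul_eq_mul, mul_comm]
    have trS : ∀ (μ : Measure E) [IsProbabilityMeasure μ], μ ≪ m →
        MemLp (fun a => √(μ.rnDeriv m a).toReal) 2 m := by
      intro μ _ hac
      simpa using trL μ hac (fun _ => 1) measurable_const (integrable_const _)
    have hrt : Integrable (fun a => r a ^ 2) (η t) := by
      refine ⟨(hr.pow_const 2).aestronglyMeasurable, ?_⟩
      rw [hasFiniteIntegral_iff_ofReal (ae_of_all _ fun _ => sq_nonneg _)]
      exact hCt.trans_lt ENNReal.coe_lt_top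
    have hMt : ∫ a, r a ^ 2 ∂(η t) ≤ M := by
      rw [integral_eq_lintegral_of_nonneg_ae (ae_of_all _ fun _ => sq_nonneg _)
        (hr.pow_const 2).aestronglyMeasurable]
      exact (ENNReal.toReal_mono ENNReal.coe_ne_top hCt).trans (le_max_left _ _)
    have key := abs_sub_le_of_root_density (trS (η t) ac) (trS η₀ ac₀) hr
      (trL (η t) ac r hr hrt) (trL η₀ ac₀ r hr hr0) (trL η₀ ac₀ b hbm hb2) ht (K := K)
      (Nat.cast_nonneg K) (M := M)
      (by simp only [mul_pow]; rwa [tr (η t) ac fun a => r a ^ 2])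
      (by simp only [mul_pow]; rw [tr η₀ ac₀ fun a => r a ^ 2]; exact le_max_right _ _)
    simp only [mul_pow _ √_] at key
    rw [tr (η t) ac, tr η₀ ac₀, tr η₀ ac₀ fun a => r a * b a, tr η₀ ac₀ fun a => b a ^ 2,
      tr η₀ ac₀ fun a => ({a | (K : ℝ) < |r a|}.indicator b a) ^ 2] at key
    have hIe : (I t).toReal = ∫ a, ((√((η t).rnDeriv m a).toReal - √(η₀.rnDeriv m a).toReal) / t
        - 1 / 2 * b a * √(η₀.rnDeriv m a).toReal) ^ 2 ∂m := by
      rw [integral_eq_lintegral_of_nonneg_ae (ae_of_all _ fun _ => sq_nonneg _)]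
      exact (((((hsm _).sub (hsm _)).div_const _).sub
        ((hbm.const_mul _).mul (hsm _))).pow_const 2).aestronglyMeasurable
    rw [hIe]
    exact key
  have hIlim : Tendsto (fun t => (I t).toReal) (𝓝[>] 0) (𝓝 0) := by
    have := (ENNReal.tendsto_toReal ENNReal.zero_ne_top).comp hb
    rwa [ENNReal.toReal_zero] at this
  have htlim : Tendsto (fun t : ℝ => t) (𝓝[>] 0) (𝓝 0) := tendsto_nhdsWithin_of_tendsto_nhds
    tendsto_id
  rw [tendsto_iff_norm_sub_tendsto_zero, Metric.tendsto_nhds]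
  intro ε hε
  -- The truncation level is fixed first, since `K ^ 2` multiplies a term that vanishes only as `t ↓
  -- 0`.
  have hK : ∀ᶠ K : ℕ in atTop, √(B' K * (4 * M)) < ε / 2 := by
    have : Tendsto (fun K => √(B' K * (4 * M))) atTop (𝓝 √(0 * (4 * M))) :=
      (Real.continuous_sqrt.tendsto _).comp (hB'lim.mul_const _)
    rw [zero_mul, Real.sqrt_zero] at this
    exact this.eventually_lt_const (by positivity)
  obtain ⟨K, hK⟩ := hK.exists
  have hlim : Tendsto (fun t => √((I t).toReal * (4 * M)) +
      √((K : ℝ) ^ 2 * B * (t ^ 2 * (2 * (I t).toReal + B)))) (𝓝[>] 0) (𝓝 0) := by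
    have h1 := (Real.continuous_sqrt.tendsto _).comp (hIlim.mul_const (4 * M))
    have h2 := (Real.continuous_sqrt.tendsto _).comp
      (((htlim.pow 2).mul ((hIlim.const_mul 2).add_const B)).const_mul ((K : ℝ) ^ 2 * B))
    simpa [Function.comp_def] using h1.add h2
  filter_upwards [bound K, hlim.eventually_lt_const (by positivity : (0 : ℝ) < ε / 2)] with t h1 h2
  rw [dist_zero_right, Real.norm_of_nonneg (norm_nonneg _), Real.norm_eq_abs]
  linarith

/-! ### Continuity in the slopes after averaging over intercepts. -/

/-- Averages of `a ↦ ∫ G (a.1 + x • a.2, x) ∂ν` over a ball in the intercepts are continuous in the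
slopes, so that a function of the slopes that is of this form on `N` has an essential limit at each
point of `N`. -/
theorem exists_tendsto_nhds_inf_ae {η : Measure RCoef} [IsProbabilityMeasure η] {ν : Measure ℝ}
    [IsProbabilityMeasure ν] {N : Set RCoef} (hN : IsOpen N) {h : ℝ → ℝ × ℝ → ℝ} {l : ℝ → ℝ}
    (hl : Measurable l) (hlpos : ∀ x, 0 < l x) (hl2 : Integrable (fun x => l x ^ 2) ν)
    (hh : ∀ᵐ x ∂ν, Continuous (h x) ∧ (∀ y, 0 ≤ h x y) ∧
      η.map (fun a => a.1 + x • a.2) = volume.withDensity (fun y => ENNReal.ofReal (h x y)) ∧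
      ∀ a ∈ N, 1 / l x ≤ h x (a.1 + x • a.2))
    {G : (ℝ × ℝ) × ℝ → ℝ} (hG : Measurable G)
    (hG2 : Integrable (fun w : RCoef × ℝ => G (w.1.1 + w.2 • w.1.2, w.2) ^ 2) (η.prod ν))
    {R : ℝ × ℝ → ℝ}
    (hR : ∀ᵐ a ∂(volume.restrict N), R a.2 = ∫ x, G (a.1 + x • a.2, x) ∂ν)
    {a : RCoef} (ha : a ∈ N) : ∃ L, Tendsto R (𝓝 a.2 ⊓ ae volume) (𝓝 L) := by
  obtain ⟨ρ, hρ, hball⟩ := Metric.isOpen_iff.1 hN a ha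
  set B₀ := Metric.ball a.1 ρ with hB₀
  set B₁ := Metric.ball a.2 ρ with hB₁
  have hsub : ∀ a₀ ∈ B₀, ∀ a₁ ∈ B₁, ((a₀, a₁) : RCoef) ∈ N := by
    intro a₀ h0 a₁ h1
    apply hball
    rw [← ball_prod_same]
    exact ⟨h0, h1⟩
  have hB₀m : MeasurableSet B₀ := measurableSet_ball
  have hB₁nhds : B₁ ∈ 𝓝 a.2 := Metric.ball_mem_nhds _ hρ
  -- domination
  have hI : Integrable (fun w : RCoef × ℝ => l w.2 * |G (w.1.1 + w.2 • w.1.2, w.2)|) (η.prod ν) := by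
    have h1 : Integrable (fun w : RCoef × ℝ => l w.2 ^ 2) (η.prod ν) := hl2.comp_snd η
    refine (h1.add hG2).mono' (by fun_prop) (ae_of_all _ fun w => ?_)
    have := hlpos w.2
    simp only [Pi.add_apply]
    rw [Real.norm_of_nonneg (by positivity), ← sq_abs (G _)]
    nlinarith [sq_nonneg (l w.2 - |G (w.1.1 + w.2 • w.1.2, w.2)|),
      sq_nonneg (l w.2), sq_nonneg |G (w.1.1 + w.2 • w.1.2, w.2)|]
  have hID := hI.integral_prod_right
  -- A majorant free of the slopes: `h x y * l x ≥ 1` at every `y = a₀ + x • a₁` with `(a₀, a₁) ∈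
  -- N`.
  set Φ : ℝ → ℝ × ℝ → ℝ := fun x y => h x y * (l x * |G (y, x)|) with hΦ
  have hΦI : ∀ᵐ x ∂ν, Integrable (Φ x) ∧
      ∫ y, Φ x y = ∫ a, l x * |G (a.1 + x • a.2, x)| ∂η := by
    filter_upwards [hh, hI.prod_left_ae] with x ⟨hc, h0, hmap, _⟩ hx
    have hm : Measurable (fun y => l x * |G (y, x)|) := by fun_prop
    have hT : Measurable (fun a : RCoef => a.1 + x • a.2) := by fun_prop
    have e1 : Integrable (fun y => l x * |G (y, x)|)
        (volume.withDensity (fun y => ENNReal.ofReal (h x y))) := by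
      rw [← hmap]
      exact (integrable_map_measure hm.aestronglyMeasurable hT.aemeasurable).2 hx
    have hd : Measurable (fun y => ENNReal.ofReal (h x y)) := hc.measurable.ennreal_ofReal
    constructor
    · have := (integrable_withDensity_iff_integrable_smul' hd
        (ae_of_all _ fun _ => ENNReal.ofReal_lt_top)).1 e1
      refine this.congr (ae_of_all _ fun y => ?_)
      simp [hΦ, ENNReal.toReal_ofReal (h0 y)]
    · have := integral_map hT.aemeasurable (hm.aestronglyMeasurable (μ := η.map _))
      rw [← this, hmap, integral_withDensity_eq_integral_toReal_smul hd
        (ae_of_all _ fun _ => ENNReal.ofReal_lt_top)]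
      refine integral_congr_ae (ae_of_all _ fun y => ?_)
      simp [hΦ, ENNReal.toReal_ofReal (h0 y)]
  -- The integrand after the substitution `y = a₀ + x • a₁`. `G` need not be continuous, as `a₁` now
  -- enters only through the indicator.
  set k : ℝ × ℝ → ℝ → ℝ × ℝ → ℝ := fun a₁ x y => B₀.indicator (fun _ => G (y, x)) (y - x • a₁)
    with hk
  have hkm : ∀ a₁, Measurable (fun w : ℝ × (ℝ × ℝ) => k a₁ w.1 w.2) := by
    intro a₁
    have : (fun w : ℝ × (ℝ × ℝ) => k a₁ w.1 w.2) =
        {w : ℝ × (ℝ × ℝ) | w.2 - w.1 • a₁ ∈ B₀}.indicator (fun w => G (w.2, w.1)) := by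
      ext w; simp [hk, Set.indicator]
    rw [this]
    refine Measurable.indicator (by fun_prop) ?_
    exact hB₀m.preimage (by fun_prop : Measurable fun w : ℝ × (ℝ × ℝ) => w.2 - w.1 • a₁)
  have hkb : ∀ᵐ x ∂ν, ∀ a₁ ∈ B₁, ∀ y, ‖k a₁ x y‖ ≤ Φ x y := by
    filter_upwards [hh] with x ⟨_, h0, _, hN'⟩ a₁ ha₁ y
    have hlx := hlpos x
    by_cases hy : y - x • a₁ ∈ B₀
    · have := hN' _ (hsub _ hy _ ha₁)
      simp only [sub_add_cancel] at this
      simp only [hk, Set.indicator_of_mem hy, hΦ, Real.norm_eq_abs]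
      have h1 : 1 ≤ h x y * l x := by rwa [div_le_iff₀ hlx] at this
      rw [← mul_assoc]
      exact le_mul_of_one_le_left (abs_nonneg _) h1
    · simp only [hk, Set.indicator_of_notMem hy, norm_zero, hΦ]
      have := h0 y
      positivity
  have hcont1 : ∀ᵐ x ∂ν, Tendsto (fun a₁ => ∫ y, k a₁ x y) (𝓝 a.2) (𝓝 (∫ y, k a.2 x y)) := by
    filter_upwards [hkb, hΦI] with x hb hi
    refine tendsto_integral_filter_of_dominated_convergence (Φ x) ?_ ?_ hi.1 ?_
    · exact Eventually.of_forall fun a₁ =>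
        ((hkm a₁).comp measurable_prodMk_left).aestronglyMeasurable
    · filter_upwards [hB₁nhds] with a₁ ha₁
      exact ae_of_all _ (hb a₁ ha₁)
    -- The indicator jumps only on the sphere, which is null because the ball is convex.
    · have hfr : ∀ᵐ y : ℝ × ℝ, y - x • a.2 ∉ frontier B₀ := by
        have h1 : ∀ᵐ y : ℝ × ℝ, y ∉ frontier B₀ :=
          measure_eq_zero_iff_ae_notMem.1 ((convex_ball a.1 ρ).addHaar_frontier volume)
        exact (measurePreserving_sub_right volume (x • a.2)).quasiMeasurePreserving.ae h1
      filter_upwards [hfr] with y hy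
      have hc : ContinuousAt (B₀.indicator (fun _ => G (y, x))) (y - x • a.2) :=
        continuousOn_const.continuousAt_indicator hy
      have ht : ContinuousAt (fun a₁ : ℝ × ℝ => y - x • a₁) a.2 := by fun_prop
      exact ContinuousAt.comp (f := fun a₁ : ℝ × ℝ => y - x • a₁) hc ht
  have hVm : ∀ a₁, AEStronglyMeasurable (fun x => ∫ y, k a₁ x y) ν := fun a₁ =>
    ((hkm a₁).stronglyMeasurable.integral_prod_right).aestronglyMeasurable
  have hcont : Tendsto (fun a₁ => ∫ x, (∫ y, k a₁ x y) ∂ν) (𝓝 a.2) (𝓝 (∫ x, (∫ y, k a.2 x y) ∂ν)) := by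
    refine tendsto_integral_filter_of_dominated_convergence _ (Eventually.of_forall hVm) ?_ hID ?_
    · filter_upwards [hB₁nhds] with a₁ ha₁
      filter_upwards [hkb, hΦI] with x hb hi
      rw [← hi.2]
      exact norm_integral_le_of_norm_le hi.1 (ae_of_all _ (hb a₁ ha₁))
    · exact hcont1
  -- the average of `R`
  have hB₀fin : volume B₀ ≠ ∞ := measure_ball_lt_top.ne
  have hB₀pos : 0 < volume.real B₀ :=
    ENNReal.toReal_pos (Metric.measure_ball_pos volume _ hρ).ne' hB₀fin
  have hswap : ∀ a₁ ∈ B₁, ∫ a₀ in B₀, ∫ x, G (a₀ + x • a₁, x) ∂ν = ∫ x, (∫ y, k a₁ x y) ∂ν := by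
    intro a₁ ha₁
    have hkey : ∀ x a₀, k a₁ x (a₀ + x • a₁) = B₀.indicator (fun a₀ => G (a₀ + x • a₁, x)) a₀ := by
      intro x a₀
      change B₀.indicator (fun _ => G (a₀ + x • a₁, x)) (a₀ + x • a₁ - x • a₁) = _
      rw [add_sub_cancel_right]
      rfl
    have hki : ∀ᵐ x ∂ν, Integrable (k a₁ x) := by
      filter_upwards [hkb, hΦI] with x hb hi
      exact hi.1.mono' ((hkm a₁).comp measurable_prodMk_left).aestronglyMeasurable
        (ae_of_all _ (hb a₁ ha₁))
    have hint : Integrable (Function.uncurry fun (a₀ : ℝ × ℝ) (x : ℝ) => G (a₀ + x • a₁, x))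
        ((volume.restrict B₀).prod ν) := by
      rw [integrable_prod_iff' (by
        exact (Measurable.aestronglyMeasurable (by unfold Function.uncurry; fun_prop)))]
      constructor
      · filter_upwards [hki] with x hx
        rw [← IntegrableOn, ← integrable_indicator_iff hB₀m]
        refine (hx.comp_add_right (x • a₁)).congr (ae_of_all _ fun a₀ => ?_)
        exact hkey x a₀
      · refine hID.mono' ?_ ?_
        · have : Measurable (fun w : ℝ × (ℝ × ℝ) => ‖G (w.2 + w.1 • a₁, w.1)‖) := by fun_prop
          exact (this.stronglyMeasurable.integral_prod_right).aestronglyMeasurable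
        · filter_upwards [hkb, hΦI] with x hb hi
          rw [← hi.2, Real.norm_of_nonneg (integral_nonneg fun _ => norm_nonneg _),
            ← integral_indicator hB₀m, ← integral_add_right_eq_self (Φ x) (x • a₁)]
          refine integral_mono_of_nonneg (ae_of_all _ fun y => ?_) (hi.1.comp_add_right _)
            (ae_of_all _ fun y => ?_)
          · exact Set.indicator_nonneg (fun _ _ => norm_nonneg _) _
          · have := hb a₁ ha₁ (y + x • a₁)
            rw [hkey] at this
            refine le_trans (le_of_eq ?_) this
            by_cases hy : y ∈ B₀ <;> simp [hy]
    rw [integral_integral_swap hint]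
    refine integral_congr_ae (ae_of_all _ fun x => ?_)
    simp only
    rw [← integral_indicator hB₀m, ← integral_add_right_eq_self (k a₁ x) (x • a₁)]
    exact integral_congr_ae (ae_of_all _ fun a₀ => (hkey x a₀).symm)
  -- By Fubini the identity holds, for almost every slope, at almost every intercept in `B₀`.
  -- Integrating over `B₀` multiplies the left side by the volume of `B₀`.
  have hRae : ∀ᵐ a₁ ∂(volume : Measure (ℝ × ℝ)), a₁ ∈ B₁ →
      R a₁ = (volume.real B₀)⁻¹ * ∫ x, (∫ y, k a₁ x y) ∂ν := by
    have h1 : ∀ᵐ a' ∂(volume.restrict (B₀ ×ˢ B₁)),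
        R a'.2 = ∫ x, G (a'.1 + x • a'.2, x) ∂ν :=
      ae_mono (Measure.restrict_mono (fun p hp => hsub _ hp.1 _ hp.2) le_rfl) hR
    rw [Measure.volume_eq_prod, ← Measure.prod_restrict] at h1
    have h2 := Measure.ae_ae_of_ae_prod (Measure.measurePreserving_swap.quasiMeasurePreserving.ae h1)
    rw [ae_restrict_iff' measurableSet_ball] at h2
    filter_upwards [h2] with a₁ h3 ha₁
    have h4 := integral_congr_ae (h3 ha₁)
    simp only [Prod.swap_prod_mk, integral_const, measureReal_restrict_apply_univ, smul_eq_mul] at h4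
    rw [← hswap a₁ ha₁, ← h4, inv_mul_cancel_left₀ hB₀pos.ne']
  refine ⟨_, Tendsto.congr' ?_ ((hcont.const_mul (volume.real B₀)⁻¹).mono_left inf_le_left)⟩
  filter_upwards [mem_inf_of_left hB₁nhds, mem_inf_of_right hRae] with a₁ h1 h2
  exact (h2 h1).symm

/-! ### Finite efficiency bound and the range of the adjoint score operator. -/

/-- A vector whose inner products with a subspace are bounded by the norm of the image under `S` is
in the range of the adjoint of `S`, up to the orthogonal complement of the subspace. -/
theorem exists_inner_eq_of_sq_le {V K : Type*} [NormedAddCommGroup V] [InnerProductSpace ℝ V]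
    [NormedAddCommGroup K] [InnerProductSpace ℝ K] [CompleteSpace K] (S : V →L[ℝ] K)
    (T : Submodule ℝ V) (χ : V) {C : ℝ} (hC : ∀ b ∈ T, inner ℝ χ b ^ 2 ≤ C * ‖S b‖ ^ 2) :
    ∃ g : K, ∀ b ∈ closure (T : Set V), inner ℝ χ b = inner ℝ g (S b) := by
  have hC' : ∀ b ∈ closure (T : Set V), inner ℝ χ b ^ 2 ≤ C * ‖S b‖ ^ 2 := by
    have hcl : IsClosed {b | inner ℝ χ b ^ 2 ≤ C * ‖S b‖ ^ 2} :=
      isClosed_le (by fun_prop) (by fun_prop)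
    have hsub : (T : Set V) ⊆ {b | inner ℝ χ b ^ 2 ≤ C * ‖S b‖ ^ 2} := fun b hb => by
      rw [Set.mem_ofPred_eq]
      exact hC b hb
    intro b hb
    have := closure_minimal hsub hcl hb
    rwa [Set.mem_ofPred_eq] at this
  set W := T.topologicalClosure with hW
  set f : W →ₗ[ℝ] ℝ := (innerSL ℝ χ).toLinearMap ∘ₗ W.subtype with hf
  set A : W →ₗ[ℝ] K := S.toLinearMap ∘ₗ W.subtype with hA
  have hfA : ∀ w : W, f w ^ 2 ≤ C * ‖A w‖ ^ 2 := fun w => hC' w w.2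
  -- The bound makes `f` vanish on the kernel of `A`, so `f` factors through `A`. The factor is
  -- bounded on the range, closed or not, and extends to `K` by Hahn–Banach.
  have hker : f ∈ (LinearMap.ker A).dualAnnihilator := by
    rw [Submodule.mem_dualAnnihilator]
    intro w hw
    have := hfA w
    rw [LinearMap.mem_ker.1 hw] at this
    have h0 : f w ^ 2 ≤ 0 := by simpa using this
    exact pow_eq_zero_iff (two_ne_zero) |>.1 (le_antisymm h0 (sq_nonneg _))
  rw [← LinearMap.range_dualMap_eq_dualAnnihilator_ker] at hker
  obtain ⟨φ, hφ⟩ := hker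
  have hφA : ∀ w, φ (A w) = f w := fun w => by rw [← hφ]; rfl
  set p := LinearMap.range A with hp
  set ψ : p →L[ℝ] ℝ := LinearMap.mkContinuous (φ ∘ₗ p.subtype) √(max C 0) (by
    rintro ⟨_, w, rfl⟩
    simp only [LinearMap.comp_apply, Submodule.subtype_apply, hφA, Submodule.coe_norm]
    rw [Real.norm_eq_abs, ← Real.sqrt_sq (norm_nonneg (A w)), ← Real.sqrt_mul (le_max_right _ _)]
    refine Real.abs_le_sqrt ((hfA w).trans ?_)
    exact mul_le_mul_of_nonneg_right (le_max_left _ _) (sq_nonneg _)) with hψ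
  obtain ⟨G, hG, -⟩ := exists_extension_norm_eq p ψ
  refine ⟨(InnerProductSpace.toDual ℝ K).symm G, fun b hb => ?_⟩
  rw [InnerProductSpace.toDual_symm_apply]
  have h1 := hG ⟨A ⟨b, hb⟩, ⟨_, rfl⟩⟩
  have h2 : ψ ⟨A ⟨b, hb⟩, ⟨_, rfl⟩⟩ = f ⟨b, hb⟩ := hφA ⟨b, hb⟩
  rw [h2] at h1
  exact h1.symm

/-- If the efficiency bound is finite, then the influence function is the conditional expectation
given `θ` of a square integrable function of the observation. -/
theorem exists_integral_eq_of_efficiencyBound_lt_top {Ω E F : Type*} [MeasurableSpace Ω]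
    [MeasurableSpace E] [MeasurableSpace F] {P : Measure Ω} [IsProbabilityMeasure P] {θ : Ω → E}
    (hθ : Measurable θ) {Z : Ω → F} (hZ : Measurable Z) {H : Set (Measure E)} {r : E → ℝ}
    (hH : IsNonparametric H r (P.map θ)) {χ : Lp ℝ 2 (P.map θ)} (hχ : ∫ a, χ a ∂(P.map θ) = 0)
    (hfin : efficiencyBound P θ Z H r χ < ⊤) :
    ∃ g : F → ℝ, Measurable g ∧ MemLp (fun ω => g (Z ω)) 2 P ∧
      ∀ b : Lp ℝ 2 (P.map θ), ∫ a, χ a * b a ∂(P.map θ) = ∫ ω, g (Z ω) * b (θ ω) ∂P := by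
  have : IsProbabilityMeasure (P.map θ) := Measure.isProbabilityMeasure_map hθ.aemeasurable
  have hmp : MeasurePreserving θ P (P.map θ) := hθ.measurePreserving P
  have hm : MeasurableSpace.comap Z inferInstance ≤ ‹MeasurableSpace Ω› := hZ.comap_le
  set J := (Lp.compMeasurePreservingₗᵢ ℝ θ hmp (E := ℝ) (p := 2)).toContinuousLinearMap with hJ
  have hJae : ∀ b : Lp ℝ 2 (P.map θ), J b =ᵐ[P] fun ω => b (θ ω) := fun b =>
    Lp.coeFn_compMeasurePreserving b hmp
  set S : Lp ℝ 2 (P.map θ) →L[ℝ] Lp ℝ 2 P :=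
    (lpMeas ℝ ℝ (MeasurableSpace.comap Z inferInstance) 2 P).subtypeL ∘L
      (condExpL2 ℝ ℝ hm) ∘L J with hS
  have hSae : ∀ b : Lp ℝ 2 (P.map θ), S b =ᵐ[P] scoreOperator P θ Z b := by
    intro b
    have hb : MemLp (fun ω => b (θ ω)) 2 P := (Lp.memLp b).comp_measurePreserving hmp
    have h1 : J b = hb.toLp _ := Lp.ext ((hJae b).trans hb.coeFn_toLp.symm)
    have h2 := hb.condExpL2_ae_eq_condExp (𝕜 := ℝ) hm
    rw [← h1] at h2
    exact h2
  have hinner : ∀ u v : Lp ℝ 2 (P.map θ), inner ℝ u v = ∫ a, u a * v a ∂(P.map θ) := by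
    intro u v
    rw [L2.inner_def]
    exact integral_congr_ae (ae_of_all _ fun a => by simp [mul_comm])
  have hbound : ∀ b ∈ tangentSpace H r (P.map θ), inner ℝ χ b ^ 2 ≤
      (efficiencyBound P θ Z H r χ).toReal * ‖S b‖ ^ 2 := by
    intro b hb
    have h1 : ENNReal.ofReal ((∫ a, χ a * b a ∂(P.map θ)) ^ 2) /
        eLpNorm (scoreOperator P θ Z b) 2 P ^ 2 ≤ efficiencyBound P θ Z H r χ :=
      le_iSup₂_of_le b hb le_rfl
    -- Zero information needs no separate case: a finite quotient by `0` in `ℝ≥0∞` has numerator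
    -- `0`.
    rw [← eLpNorm_congr_ae (hSae b), ENNReal.div_le_iff_le_mul (Or.inr hfin.ne)
      (Or.inl (ENNReal.pow_ne_top (Lp.eLpNorm_ne_top _)))] at h1
    have h2 := ENNReal.toReal_mono (ENNReal.mul_ne_top hfin.ne
      (ENNReal.pow_ne_top (Lp.eLpNorm_ne_top _))) h1
    rw [ENNReal.toReal_ofReal (sq_nonneg _), ENNReal.toReal_mul, ENNReal.toReal_pow,
      ← Lp.norm_def, ← hinner] at h2
    exact h2
  obtain ⟨G, hG⟩ := exists_inner_eq_of_sq_le S (tangentSpace H r (P.map θ)) χ hbound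
  -- Projecting the representer changes no product with the range of `S` and makes it a function of
  -- `Z`.
  set G' : Lp ℝ 2 P := (condExpL2 ℝ ℝ hm G).1 with hG'
  obtain ⟨g', hg'm, hg'ae⟩ := aestronglyMeasurable_condExpL2 (𝕜 := ℝ) hm G
  obtain ⟨g, hgm, rfl⟩ := hg'm.measurable.exists_eq_measurable_comp
  have hgLp : MemLp (fun ω => g (Z ω)) 2 P := (Lp.memLp G').ae_eq hg'ae
  have hGJ : ∀ b, inner ℝ G (S b) = ∫ ω, g (Z ω) * b (θ ω) ∂P := by
    intro b
    have h1 : inner ℝ G (S b) = inner ℝ G' (J b) := (inner_condExpL2_left_eq_right hm).symm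
    rw [h1, L2.inner_def]
    refine integral_congr_ae ?_
    filter_upwards [hg'ae, hJae b] with ω h2 h3
    have h2' : G' ω = g (Z ω) := h2
    rw [h3, h2']
    simp [mul_comm]
  have hzero : ∀ b : Lp ℝ 2 (P.map θ), ∫ a, b a ∂(P.map θ) = 0 →
      ∫ a, χ a * b a ∂(P.map θ) = ∫ ω, g (Z ω) * b (θ ω) ∂P := by
    intro b hb
    rw [← hinner, hG b (hH b hb), hGJ]
  -- Density gives the identity for mean zero `b` only. As `χ` has mean zero, centring `g` extends
  -- it to every `b`.
  set c := ∫ ω, g (Z ω) ∂P with hc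
  have hgI : Integrable (fun ω => g (Z ω)) P := hgLp.integrable one_le_two
  refine ⟨fun z => g z - c, hgm.sub_const c, hgLp.sub (memLp_const c), fun b => ?_⟩
  have hbθ : MemLp (fun ω => b (θ ω)) 2 P := (Lp.memLp b).comp_measurePreserving hmp
  set d := ∫ a, b a ∂(P.map θ) with hd
  have hdθ : d = ∫ ω, b (θ ω) ∂P :=
    integral_map hθ.aemeasurable (Lp.aestronglyMeasurable b)
  have hbc : MemLp (fun a => b a - d) 2 (P.map θ) := (Lp.memLp b).sub (memLp_const d)
  have hbI : Integrable b (P.map θ) := (Lp.memLp b).integrable one_le_two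
  have hbIθ : Integrable (fun ω => b (θ ω)) P := hbθ.integrable one_le_two
  have hcoe := hbc.coeFn_toLp
  have h1 := hzero (hbc.toLp _) (by
    rw [integral_congr_ae hcoe, integral_sub hbI (integrable_const d)]
    simp [hd])
  have h2 : ∫ a, χ a * hbc.toLp _ a ∂(P.map θ) = ∫ a, χ a * b a ∂(P.map θ) := by
    have h3 : ∫ a, χ a * hbc.toLp _ a ∂(P.map θ) = ∫ a, (χ a * b a - χ a * d) ∂(P.map θ) := by
      refine integral_congr_ae ?_
      filter_upwards [hcoe] with a ha
      rw [ha]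
      ring
    have h7 : Integrable (fun a => χ a * b a) (P.map θ) :=
      (Lp.memLp χ).integrable_mul (Lp.memLp b)
    rw [h3, integral_sub h7
      (((Lp.memLp χ).integrable one_le_two).mul_const d), integral_mul_const, hχ]
    simp
  have h4 : ∫ ω, g (Z ω) * hbc.toLp _ (θ ω) ∂P = ∫ ω, (g (Z ω) - c) * b (θ ω) ∂P := by
    have h5 : ∫ ω, g (Z ω) * hbc.toLp _ (θ ω) ∂P =
        ∫ ω, (g (Z ω) * b (θ ω) - g (Z ω) * d) ∂P := by
      refine integral_congr_ae ?_
      filter_upwards [ae_of_ae_map hθ.aemeasurable hcoe] with ω hω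
      rw [hω]
      ring
    have h6 : Integrable (fun ω => g (Z ω) * b (θ ω)) P := hgLp.integrable_mul hbθ
    simp only [sub_mul]
    rw [h5, integral_sub h6 (hgI.mul_const d), integral_sub h6 (hbIθ.const_mul c),
      integral_mul_const, integral_const_mul, hdθ]
  rw [← h2, h1, h4]

/-! ### Influence functions. -/

section Efficiency

variable {E : Type*} [MeasurableSpace E] {H : Set (Measure E)} {r : E → ℝ} {η₀ : Measure E}

theorem IsSubmodel.eventually_isProbabilityMeasure {η : ℝ → Measure E} {b : Lp ℝ 2 η₀}
    (h : IsSubmodel H r η₀ η b) (hH : ∀ η ∈ H, IsProbabilityMeasure η) :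
    ∀ᶠ t in 𝓝[>] (0 : ℝ), IsProbabilityMeasure (η t) := by
  obtain ⟨ε, hε, hmem⟩ := h.mem
  filter_upwards [Ioo_mem_nhdsGT hε] with t ht
  exact hH _ (hmem t ⟨ht.1.le, ht.2⟩)

/-- Total mass is constant along the path, so the derivative of the moment of the constant `1` is
zero. -/
theorem IsSubmodel.integral_score_eq_zero [IsProbabilityMeasure η₀] {η : ℝ → Measure E}
    {b : Lp ℝ 2 η₀} (h : IsSubmodel H r η₀ η b) (hH : ∀ η ∈ H, IsProbabilityMeasure η) :
    ∫ a, b a ∂η₀ = 0 := by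
  have hη := h.eventually_isProbabilityMeasure hH
  have key := tendsto_of_hasScore hη h.score (r := fun _ => 1) (C := 1) measurable_const
    (integrable_const _) (by filter_upwards [hη] with t _; simp)
  simp only [one_mul] at key
  refine tendsto_nhds_unique key (tendsto_const_nhds.congr' ?_)
  filter_upwards [hη] with t _
  simp

/-- The centered moment function is an influence function. -/
theorem exists_isInfluenceFunction [IsProbabilityMeasure η₀]
    (hH : ∀ η ∈ H, IsProbabilityMeasure η) (hr : Measurable r) (hr2 : MemLp r 2 η₀) :
    ∃ χ : Lp ℝ 2 η₀, (∀ᵐ a ∂η₀, χ a = r a - ∫ a, r a ∂η₀) ∧ IsInfluenceFunction H r η₀ χ := by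
  set c := ∫ a, r a ∂η₀ with hc
  have hχ : MemLp (fun a => r a - c) 2 η₀ := hr2.sub (memLp_const c)
  have hcoe := hχ.coeFn_toLp
  have hrI : Integrable r η₀ := hr2.integrable one_le_two
  refine ⟨hχ.toLp _, hcoe, ?_, fun η b h => ?_⟩
  · rw [integral_congr_ae hcoe, integral_sub hrI (integrable_const c)]
    simp [hc]
  · have hη := h.eventually_isProbabilityMeasure hH
    obtain ⟨C, hC⟩ := h.moment
    have key := tendsto_of_hasScore hη h.score hr hr2.integrable_sq hC
    have e : ∫ a, hχ.toLp _ a * b a ∂η₀ = ∫ a, r a * b a ∂η₀ := by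
      have h1 : ∫ a, hχ.toLp _ a * b a ∂η₀ = ∫ a, (r a * b a - c * b a) ∂η₀ := by
        refine integral_congr_ae ?_
        filter_upwards [hcoe] with a ha
        rw [ha]
        ring
      have h2 : Integrable (fun a => r a * b a) η₀ := hr2.integrable_mul (Lp.memLp b)
      rw [h1, integral_sub h2
        (((Lp.memLp b).integrable one_le_two).const_mul c), integral_const_mul,
        h.integral_score_eq_zero hH]
      simp
    rw [e]
    exact key

/-- All influence functions have the same inner products with tangents. -/
theorem IsInfluenceFunction.integral_mul_eq {χ χ' : Lp ℝ 2 η₀}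
    (h : IsInfluenceFunction H r η₀ χ) (h' : IsInfluenceFunction H r η₀ χ') {b : Lp ℝ 2 η₀}
    (hb : b ∈ tangentSpace H r η₀) : ∫ a, χ a * b a ∂η₀ = ∫ a, χ' a * b a ∂η₀ := by
  have hinner : ∀ u v : Lp ℝ 2 η₀, ∫ a, u a * v a ∂η₀ = inner ℝ u v := by
    intro u v
    rw [L2.inner_def]
    exact integral_congr_ae (ae_of_all _ fun a => by simp [mul_comm])
  rw [hinner, hinner]
  induction hb using Submodule.span_induction with
  | mem b hb =>
    obtain ⟨η, hη⟩ := hb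
    rw [← hinner, ← hinner]
    exact tendsto_nhds_unique (h.2 η b hη) (h'.2 η b hη)
  | zero => simp
  | add x y _ _ hx hy => rw [inner_add_right, inner_add_right, hx, hy]
  | smul c x _ hx => rw [inner_smul_right, inner_smul_right, hx]

/-- The bound sees `χ` only through its products with tangents. Hence one influence function with
infinite bound excludes regular identification. -/
theorem IsInfluenceFunction.efficiencyBound_eq {Ω F : Type*} [MeasurableSpace Ω]
    [MeasurableSpace F] {P : Measure Ω} {θ : Ω → E} {Z : Ω → F} {χ χ' : Lp ℝ 2 (P.map θ)}
    (h : IsInfluenceFunction H r (P.map θ) χ) (h' : IsInfluenceFunction H r (P.map θ) χ') :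
    efficiencyBound P θ Z H r χ = efficiencyBound P θ Z H r χ' := by
  unfold efficiencyBound
  exact iSup_congr fun b => iSup_congr fun hb => by rw [h.integral_mul_eq h' hb]

end Efficiency

/-! ### From the triangular model to its reduced form. -/

theorem measurable_reducedForm : Measurable reducedForm := by
  unfold reducedForm
  fun_prop

theorem measurable_observation : Measurable observation := by
  unfold observation
  fun_prop

theorem observation_eq (t : Coef) (x : ℝ) :
    observation (t, x) = (((reducedForm t).1 + x • (reducedForm t).2).1,
      ((reducedForm t).1 + x • (reducedForm t).2).2, x) := by
  simp only [observation, reducedForm, Prod.fst_add, Prod.snd_add, Prod.smul_fst, Prod.smul_snd,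
    smul_eq_mul]
  ext
  · simp only; ring
  · simp only; ring
  · rfl

theorem HasBoundedDensity.absolutelyContinuous {E : Type*} [MeasureSpace E] {μ : Measure E}
    (h : HasBoundedDensity μ) : μ ≪ volume := by
  obtain ⟨f, C, -, -, rfl⟩ := h
  exact withDensity_absolutelyContinuous _ _

theorem ae_rcoef_slope_ne_zero : ∀ᵐ a ∂(volume : Measure RCoef), a.2.2 ≠ 0 := by
  have h0 : ∀ᵐ d ∂(volume : Measure ℝ), d ≠ 0 := by simp [ae_iff]
  have h1 : ∀ᵐ q ∂(volume : Measure (ℝ × ℝ)), q.2 ≠ 0 :=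
    Measure.quasiMeasurePreserving_snd.ae h0
  exact Measure.quasiMeasurePreserving_snd.ae h1

/-- A moment of a function of the slopes of the reduced form without an essential limit at some
point of `N` has an infinite efficiency bound. -/
theorem not_isRegularlyIdentified_of_not_tendsto {Ω : Type*} [MeasurableSpace Ω] {P : Measure Ω}
    [IsProbabilityMeasure P] {γ U₁ δ U₂ X Y₁ Y₂ : Ω → ℝ} {θ : Ω → Coef} {Z : Ω → ℝ × ℝ × ℝ}
    (hθ : θ = fun ω => (γ ω, U₁ ω, δ ω, U₂ ω)) (hZ : Z = fun ω => (Y₁ ω, Y₂ ω, X ω))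
    (hmodel : IsTriangularModel P γ U₁ δ U₂ X Y₁ Y₂) {N : Set RCoef}
    (hreduced : ReducedFormCondition (P.map (fun ω => reducedForm (θ ω))) (P.map X) N)
    {H : Set (Measure Coef)} (hprob : ∀ η ∈ H, IsProbabilityMeasure η)
    {r : Coef → ℝ} (hr : Measurable r) (hr2 : MemLp r 2 (P.map θ))
    (hH : IsNonparametric H r (P.map θ)) {R : ℝ × ℝ → ℝ} (hRm : Measurable R)
    (hR : ∀ t : Coef, t.2.2.1 ≠ 0 → r t = R (reducedForm t).2) {a : RCoef} (ha : a ∈ N)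
    (hlim : ¬ ∃ L, Tendsto R (𝓝 a.2 ⊓ ae volume) (𝓝 L)) :
    ¬ IsRegularlyIdentified P θ X Z H r ∧ HasInfiniteEfficiencyBound P θ Z H r := by
  have hXm := hmodel.measurable_X
  have hθm : Measurable θ := by
    rw [hθ]
    exact hmodel.measurable_γ.prodMk (hmodel.measurable_U₁.prodMk
      (hmodel.measurable_δ.prodMk hmodel.measurable_U₂))
  have hind : IndepFun θ X P := by rw [hθ]; exact hmodel.exogenous
  have hZobs : ∀ ω, Z ω = observation (θ ω, X ω) := by
    intro ω
    simp only [hZ, hθ, observation, hmodel.outcome, hmodel.firstStage]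
  have hZm : Measurable Z := by
    rw [funext hZobs]
    exact measurable_observation.comp (hθm.prodMk hXm)
  have : IsProbabilityMeasure (P.map θ) := Measure.isProbabilityMeasure_map hθm.aemeasurable
  have : IsProbabilityMeasure (P.map X) := Measure.isProbabilityMeasure_map hXm.aemeasurable
  have hαm : Measurable fun ω => reducedForm (θ ω) := measurable_reducedForm.comp hθm
  have : IsProbabilityMeasure (P.map fun ω => reducedForm (θ ω)) :=
    Measure.isProbabilityMeasure_map hαm.aemeasurable
  obtain ⟨χ, hχr, hχ⟩ := exists_isInfluenceFunction hprob hr hr2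
  set c := ∫ a, r a ∂(P.map θ) with hc
  suffices htop : efficiencyBound P θ Z H r χ = ⊤ by
    refine ⟨fun ⟨_, χ', hχ', hfin⟩ => ?_, χ, hχ, htop⟩
    rw [hχ'.efficiencyBound_eq hχ, htop] at hfin
    exact lt_irrefl _ hfin
  by_contra hfin
  obtain ⟨g, hgm, hg2, hg⟩ := exists_integral_eq_of_efficiencyBound_lt_top hθm hZm hH hχ.1
    (lt_top_iff_ne_top.2 hfin)
  have hprod : P.map (fun ω => (θ ω, X ω)) = (P.map θ).prod (P.map X) :=
    (indepFun_iff_map_prod_eq_prod_map_map hθm.aemeasurable hXm.aemeasurable).1 hind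
  have hgobs : Integrable (fun w : Coef × ℝ => g (observation w)) ((P.map θ).prod (P.map X)) := by
    rw [← hprod]
    refine (integrable_map_measure (hgm.comp measurable_observation).aestronglyMeasurable
      (hθm.prodMk hXm).aemeasurable).2 ?_
    refine (hg2.integrable one_le_two).congr (ae_of_all _ fun ω => ?_)
    simp only [Function.comp_apply, hZobs]
  -- Testing against indicators of events in `θ` identifies `χ` with `E[g(Z) | θ]`, which by
  -- independence is an integral over the law of `X`.
  have hcond : ∀ᵐ t ∂(P.map θ), χ t = ∫ x, g (observation (t, x)) ∂(P.map X) := by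
    refine Integrable.ae_eq_of_forall_setIntegral_eq _ _ ((Lp.memLp χ).integrable one_le_two)
      hgobs.integral_prod_left fun A hA _ => ?_
    have h1 := hg (indicatorConstLp 2 hA (measure_ne_top _ _) 1)
    have hcoe := indicatorConstLp_coeFn (p := 2) (hs := hA)
      (hμs := measure_ne_top (P.map θ) A) (c := (1 : ℝ))
    have h2 : ∫ a, χ a * indicatorConstLp 2 hA (measure_ne_top (P.map θ) A) (1 : ℝ) a ∂(P.map θ)
        = ∫ a in A, χ a ∂(P.map θ) := by
      rw [← integral_indicator hA]
      refine integral_congr_ae ?_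
      filter_upwards [hcoe] with a ha
      rw [ha]
      by_cases h : a ∈ A <;> simp [h]
    have h3 : ∫ ω, g (Z ω) * indicatorConstLp 2 hA (measure_ne_top (P.map θ) A) (1 : ℝ) (θ ω) ∂P
        = ∫ ω, A.indicator (fun _ => g (observation (θ ω, X ω))) (θ ω) ∂P := by
      refine integral_congr_ae ?_
      filter_upwards [ae_of_ae_map hθm.aemeasurable hcoe] with ω hω
      rw [hω, hZobs]
      by_cases h : θ ω ∈ A <;> simp [h]
    have hset : (fun w : Coef × ℝ => A.indicator (fun _ => g (observation w)) w.1) =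
        (A ×ˢ Set.univ).indicator (fun w => g (observation w)) := by
      ext w
      by_cases h : w.1 ∈ A <;> simp [h]
    have hmeas : Measurable (fun w : Coef × ℝ => A.indicator (fun _ => g (observation w)) w.1) := by
      rw [hset]
      exact (hgm.comp measurable_observation).indicator (hA.prod MeasurableSet.univ)
    have h4 : ∫ ω, A.indicator (fun _ => g (observation (θ ω, X ω))) (θ ω) ∂P =
        ∫ w, A.indicator (fun _ => g (observation w)) w.1 ∂((P.map θ).prod (P.map X)) := by
      rw [← hprod, integral_map (hθm.prodMk hXm).aemeasurable hmeas.aestronglyMeasurable]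
    rw [← h2, h1, h3, h4, hset, integral_indicator (hA.prod MeasurableSet.univ),
      setIntegral_prod _ hgobs.integrableOn]
    simp
  set G : (ℝ × ℝ) × ℝ → ℝ := fun q => g (q.1.1, q.1.2, q.2) with hG
  have hGm : Measurable G := hgm.comp (by fun_prop)
  have hobs : ∀ t x, g (observation (t, x)) =
      G ((reducedForm t).1 + x • (reducedForm t).2, x) := fun t x => by rw [observation_eq]
  have hset : MeasurableSet {a : RCoef | R a.2 - c = ∫ x, G (a.1 + x • a.2, x) ∂(P.map X)} := by
    refine measurableSet_eq_fun ((hRm.comp measurable_snd).sub_const c) ?_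
    have : Measurable fun w : RCoef × ℝ => G (w.1.1 + w.2 • w.1.2, w.2) := by fun_prop
    exact this.stronglyMeasurable.integral_prod_right.measurable
  have hα : ∀ᵐ a ∂(P.map fun ω => reducedForm (θ ω)),
      R a.2 - c = ∫ x, G (a.1 + x • a.2, x) ∂(P.map X) := by
    rw [ae_map_iff hαm.aemeasurable hset]
    -- `γ` is recovered as `π₁ / δ` only where `δ ≠ 0`, which is almost sure because `α` has a
    -- density.
    have hne := ae_of_ae_map hαm.aemeasurable
      (hreduced.boundedDensity.absolutelyContinuous.ae_le ae_rcoef_slope_ne_zero)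
    filter_upwards [hne, ae_of_ae_map hθm.aemeasurable hcond, ae_of_ae_map hθm.aemeasurable hχr]
      with ω h1 h2 h3
    rw [← hR (θ ω) h1, ← h3, h2]
    simp only [hobs]
  obtain ⟨h, l, hl, hlpos, hl2, hh⟩ := hreduced.outcomeDensity
  -- The identity holds almost surely under the law of `α`; positivity of its density turns this
  -- into Lebesgue almost everywhere on `N`.
  obtain ⟨L, hL⟩ := exists_tendsto_nhds_inf_ae hreduced.isOpen hl hlpos hl2 hh hGm (by
    rw [← (indepFun_iff_map_prod_eq_prod_map_map hαm.aemeasurable hXm.aemeasurable).1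
      (hind.comp measurable_reducedForm measurable_id),
      integrable_map_measure (Measurable.aestronglyMeasurable (by fun_prop))
        (hαm.prodMk hXm).aemeasurable]
    refine hg2.integrable_sq.congr (ae_of_all _ fun ω => ?_)
    simp only [Function.comp_apply, hZobs, hobs]) (R := fun q => R q - c)
    (hreduced.positive.ae_le hα) ha
  exact hlim ⟨L + c, by simpa using hL.add_const c⟩

/-! ### Absence of essential limits. -/

/-- Each neighbourhood of `q` meets `O` in a nonempty open set, which has positive measure. An
essential limit at `q` must therefore agree with the values on `O`. -/
theorem frequently_nhds_inf_ae_of_mem_closure {O : Set (ℝ × ℝ)} (hO : IsOpen O) {q : ℝ × ℝ}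
    (hq : q ∈ closure O) : ∃ᶠ p in 𝓝 q ⊓ ae volume, p ∈ O := by
  intro h
  obtain ⟨u, hu, v, hv, huv⟩ := mem_inf_iff_superset.1 h
  obtain ⟨w, hwu, hw, hqw⟩ := mem_nhds_iff.1 hu
  have hpos : 0 < volume (w ∩ O) := (hw.inter hO).measure_pos _ (mem_closure_iff.1 hq w hw hqw)
  have hsub : w ∩ O ⊆ vᶜ := fun p hp hpv => by
    have := huv ⟨hwu hp.1, hpv⟩
    simp only [Set.mem_ofPred_eq] at this
    exact this hp.2
  exact hpos.ne' (measure_mono_null hsub hv)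

theorem mem_closure_of_frequently {O : Set (ℝ × ℝ)} {p d u v : ℝ}
    (h : ∃ᶠ e in 𝓝[>] (0 : ℝ), (p + e * u, d + e * v) ∈ O) : (p, d) ∈ closure O := by
  refine mem_closure_of_frequently_of_tendsto h ?_
  have : Continuous fun e : ℝ => (p + e * u, d + e * v) := by fun_prop
  simpa using (this.tendsto 0).mono_left (nhdsWithin_le_nhds (s := Set.Ioi 0))

theorem not_tendsto_indicator_div {p d : ℝ} (h : p * d = 0) :
    ¬ ∃ L, Tendsto ({q : ℝ × ℝ | 0 < q.1 / q.2}.indicator fun _ => (1 : ℝ))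
      (𝓝 (p, d) ⊓ ae volume) (𝓝 L) := by
  rintro ⟨L, hL⟩
  have key : ∀ σ : ℝ, σ ≠ 0 →
      ∃ᶠ q in 𝓝 (p, d) ⊓ ae volume, q ∈ {q : ℝ × ℝ | 0 < σ * (q.1 * q.2)} := by
    intro σ hσ
    have hO : IsOpen {q : ℝ × ℝ | 0 < σ * (q.1 * q.2)} :=
      isOpen_lt continuous_const (by fun_prop)
    -- Away from the origin, move along `σ` times the gradient `(d, p)` of the product. At the
    -- origin the gradient vanishes, and the direction `(σ, 1)` gives the product the sign of `σ` at
    -- second order.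
    have hdir : ∃ u v : ℝ, ∀ e > 0, 0 < σ * ((p + e * u) * (d + e * v)) := by
      rcases eq_or_ne p 0 with rfl | hp
      · rcases eq_or_ne d 0 with rfl | hd
        · refine ⟨σ, 1, fun e he => ?_⟩
          have : σ * ((0 + e * σ) * (0 + e * 1)) = σ ^ 2 * e ^ 2 := by ring
          rw [this]
          positivity
        · refine ⟨σ * d, 0, fun e he => ?_⟩
          have : σ * ((0 + e * (σ * d)) * (d + e * 0)) = σ ^ 2 * d ^ 2 * e := by ring
          rw [this]
          positivity
      · obtain rfl : d = 0 := (mul_eq_zero.1 h).resolve_left hp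
        refine ⟨0, σ * p, fun e he => ?_⟩
        have : σ * ((p + e * 0) * (0 + e * (σ * p))) = σ ^ 2 * p ^ 2 * e := by ring
        rw [this]
        positivity
    obtain ⟨u, v, huv⟩ := hdir
    refine frequently_nhds_inf_ae_of_mem_closure hO
      (mem_closure_of_frequently (u := u) (v := v) (Eventually.frequently ?_))
    filter_upwards [self_mem_nhdsWithin] with e he using huv e he
  have h1 : L ∈ ({1} : Set ℝ) := isClosed_singleton.mem_of_frequently_of_tendsto
    ((key 1 one_ne_zero).mono fun q hq => by
      have hq' : 0 < q.1 * q.2 := by simpa using hq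
      have : q ∈ {q : ℝ × ℝ | 0 < q.1 / q.2} := by
        rw [Set.mem_ofPred_eq, div_pos_iff]
        exact mul_pos_iff.1 hq'
      rw [Set.indicator_of_mem this]
      rfl) hL
  have h0 : L ∈ ({0} : Set ℝ) := isClosed_singleton.mem_of_frequently_of_tendsto
    ((key (-1) (by norm_num)).mono fun q hq => by
      have hq' : q.1 * q.2 < 0 := by simpa using hq
      have : q ∉ {q : ℝ × ℝ | 0 < q.1 / q.2} := by
        rw [Set.mem_ofPred_eq, div_pos_iff, ← mul_pos_iff]
        exact hq'.not_gt
      rw [Set.indicator_of_notMem this]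
      rfl) hL
  rw [Set.mem_singleton_iff] at h0 h1
  linarith

theorem not_tendsto_div (p : ℝ) :
    ¬ ∃ L, Tendsto (fun q : ℝ × ℝ => q.1 / q.2) (𝓝 (p, 0) ⊓ ae volume) (𝓝 L) := by
  rintro ⟨L, hL⟩
  obtain ⟨c, hc, hLc⟩ : ∃ c : ℝ, 0 < c ∧ L < c :=
    ⟨max L 0 + 1, by positivity, by linarith [le_max_left L 0]⟩
  have hO : IsOpen {q : ℝ × ℝ | c * q.2 ^ 2 < q.1 * q.2} :=
    isOpen_lt (by fun_prop) (by fun_prop)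
  -- The set is `q.1 / q.2 > c` cleared of its denominator. For `p = 0` it contains the ray on which
  -- the ratio is `c + 1`; for `p ≠ 0` the second coordinate tends to zero with the sign of `p`.
  have hcl : (p, 0) ∈ closure {q : ℝ × ℝ | c * q.2 ^ 2 < q.1 * q.2} := by
    rcases eq_or_ne p 0 with rfl | hp
    · refine mem_closure_of_frequently (u := c + 1) (v := 1) (Eventually.frequently ?_)
      filter_upwards [self_mem_nhdsWithin] with e he
      have he' : (0 : ℝ) < e := he
      nlinarith [pow_pos he' 2]
    · refine mem_closure_of_frequently (u := 0) (v := p) (Eventually.frequently ?_)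
      filter_upwards [Ioo_mem_nhdsGT (inv_pos.2 hc)] with e ⟨he, hec⟩
      have h1 : c * e < 1 := by
        calc c * e < c * c⁻¹ := by gcongr
          _ = 1 := mul_inv_cancel₀ hc.ne'
      have h2 : 0 < e * p ^ 2 := by positivity
      nlinarith
  obtain ⟨q, hq, hqc⟩ := ((frequently_nhds_inf_ae_of_mem_closure hO hcl).and_eventually
    (hL.eventually_lt_const hLc)).exists
  rw [Set.mem_ofPred_eq] at hq
  have hq2 : q.2 ≠ 0 := fun h => by simp [h] at hq
  have hq3 : q.1 * q.2 = q.1 / q.2 * q.2 ^ 2 := by field_simp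
  rw [hq3] at hq
  have : 0 < q.2 ^ 2 := by positivity
  nlinarith

end TriangularRC

/-! ### Application to the two moments. -/

theorem proposition5 {Ω : Type*} [MeasurableSpace Ω] (P : Measure Ω) [IsProbabilityMeasure P]
    (γ U₁ δ U₂ X Y₁ Y₂ : Ω → ℝ) (θ : Ω → TriangularRC.Coef) (Z : Ω → ℝ × ℝ × ℝ)
    (hθ : θ = fun ω => (γ ω, U₁ ω, δ ω, U₂ ω)) (hZ : Z = fun ω => (Y₁ ω, Y₂ ω, X ω))
    (hmodel : TriangularRC.IsTriangularModel P γ U₁ δ U₂ X Y₁ Y₂)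
    (N : Set TriangularRC.RCoef)
    (hreduced : TriangularRC.ReducedFormCondition
      (P.map (fun ω => TriangularRC.reducedForm (θ ω))) (P.map X) N)
    (H : Set (Measure TriangularRC.Coef)) (hprob : ∀ η ∈ H, IsProbabilityMeasure η)
    (hmem : P.map θ ∈ H) :
    (TriangularRC.IsNonparametric H TriangularRC.ppame (P.map θ) →
      ((∃ p₀ u₂ d₀ : ℝ, ((p₀, u₂), (0, d₀)) ∈ N) ∨ (∃ p₀ u₂ p₁ : ℝ, ((p₀, u₂), (p₁, 0)) ∈ N)) →
      ¬ TriangularRC.IsRegularlyIdentified P θ X Z H TriangularRC.ppame ∧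
        TriangularRC.HasInfiniteEfficiencyBound P θ Z H TriangularRC.ppame) ∧
    (TriangularRC.IsNonparametric H TriangularRC.ame (P.map θ) →
      (∃ p₀ u₂ p₁ : ℝ, ((p₀, u₂), (p₁, 0)) ∈ N) →
      Integrable (fun ω => γ ω ^ 2) P →
      ¬ TriangularRC.IsRegularlyIdentified P θ X Z H TriangularRC.ame ∧
        TriangularRC.HasInfiniteEfficiencyBound P θ Z H TriangularRC.ame) := by
  have hθm : Measurable θ := by
    rw [hθ]
    exact hmodel.measurable_γ.prodMk (hmodel.measurable_U₁.prodMk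
      (hmodel.measurable_δ.prodMk hmodel.measurable_U₂))
  have : IsProbabilityMeasure (P.map θ) := Measure.isProbabilityMeasure_map hθm.aemeasurable
  refine ⟨fun hH hN => ?_, fun hH ⟨p₀, u₂, p₁, ha⟩ hγ => ?_⟩
  · have hS : MeasurableSet {t : TriangularRC.Coef | 0 < t.1} :=
      measurableSet_lt measurable_const measurable_fst
    have hr : Measurable TriangularRC.ppame := measurable_const.indicator hS
    have hr2 : MemLp TriangularRC.ppame 2 (P.map θ) := (memLp_const (1 : ℝ)).indicator hS
    obtain ⟨a, ha, ha0⟩ : ∃ a ∈ N, a.2.1 * a.2.2 = 0 := by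
      rcases hN with ⟨p₀, u₂, d₀, h⟩ | ⟨p₀, u₂, p₁, h⟩
      · exact ⟨_, h, by simp⟩
      · exact ⟨_, h, by simp⟩
    refine TriangularRC.not_isRegularlyIdentified_of_not_tendsto hθ hZ hmodel hreduced hprob hr hr2
      hH (R := {q : ℝ × ℝ | 0 < q.1 / q.2}.indicator fun _ => (1 : ℝ))
      (measurable_const.indicator (measurableSet_lt measurable_const (by fun_prop)))
      (fun t ht => ?_) ha (TriangularRC.not_tendsto_indicator_div ha0)
    simp [TriangularRC.ppame, TriangularRC.reducedForm, Set.indicator_apply, ht]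
  · have hr : Measurable TriangularRC.ame := measurable_fst
    have hr2 : MemLp TriangularRC.ame 2 (P.map θ) := by
      rw [memLp_two_iff_integrable_sq hr.aestronglyMeasurable,
        integrable_map_measure (hr.pow_const 2).aestronglyMeasurable hθm.aemeasurable]
      simpa only [Function.comp_def, hθ, TriangularRC.ame] using hγ
    refine TriangularRC.not_isRegularlyIdentified_of_not_tendsto hθ hZ hmodel hreduced hprob hr hr2
      hH (R := fun q => q.1 / q.2) (by fun_prop) (fun t ht => ?_) ha
      (TriangularRC.not_tendsto_div p₁)
    simp [TriangularRC.ame, TriangularRC.reducedForm, ht]
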